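/- **The language ECPS.** Types are $A ::= \neg(A_1,\ldots,A_n)\mid \mathtt{nat}\mid\mathtt{unit}$ ($n\ge 0$). Fix a set $\Sigma$ of effect operations. Values and computations, taken up to $\alpha$-conversion, are $$v,w ::= \mathtt{zero}\mid\mathtt{succ}(v)\mid\star\mid\lambda(x_1,\ldots,x_n){:}(A_1,\ldots,A_n).\,t\mid x,$$ $$t,u ::= v(w_1,\ldots,w_n)\mid(\mu x.v)(\overrightarrow w)\mid\sigma(v,x.t)\mid{\downarrow}\mid\mathtt{case}\ v\ \mathtt{in}\ \{\mathtt{zero}\Rightarrow t,\ \mathtt{succ}(x)\Rightarrow u\}\qquad(\sigma\in\Sigma).$$ The judgements $\Gamma\vdash v:A$ and $\Gamma\vdash t$ (computations have no type) are given by the usual rules: variables have the type declared in $\Gamma$; $\mathtt{zero}:\mathtt{nat}$; $\mathtt{succ}(v):\mathtt{nat}$ if $v:\mathtt{nat}$; $\star:\mathtt{unit}$; $\lambda(\overrightarrow x){:}(\overrightarrow A).t:\neg(\overrightarrow A)$ if $\Gamma,\overrightarrow{x:A}\vdash t$; $v(\overrightarrow w)$ is well typed if $v:\neg(\overrightarrow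 A)$ and $\overrightarrow w:\overrightarrow A$; $(\mu x.v)(\overrightarrow w)$ if $\Gamma,x:\neg(\overrightarrow A)\vdash v:\neg(\overrightarrow A)$ and $\overrightarrow w:\overrightarrow A$; $\sigma(v,x.t)$ if $v:\mathtt{nat}$ and $\Gamma,x:\mathtt{nat}\vdash t$; ${\downarrow}$ always; the case term if $v:\mathtt{nat}$, $\Gamma\vdash t$ and $\Gamma,x:\mathtt{nat}\vdash u$. Write $\overline n=\mathtt{succ}^n(\mathtt{zero})$. Closed computations reduce by $$(\lambda(\overrightarrow x){:}(\overrightarrow A).t)(\overrightarrow w)\to t[\overrightarrow w/\overrightarrow x],\qquad (\mu x.v)(\overrightarrow w)\to \bigl(v[\lambda(\overrightarrow y){:}(\overrightarrow A).(\mu x.v)(\overrightarrow y)/x]\bigr)(\overrightarrow w),$$ $\mathtt{case}\ \mathtt{zero}\ \mathtt{in}\ \{\mathtt{zero}\Rightarrow s,\mathtt{succ}(x)\Rightarrow t\}\to s$, and $\mathtt{case}\ \mathtt{succ}(v)\ \mathtt{in}\ \{\mathtt{zero}\Rightarrow s,\mathtt{succ}(x)\Rightarrow t\}\to t[v/x]$.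 **Effect trees.** $\mathit{Trees}_\Sigma$ is the set of trees of possibly infinite depth with leaves $\bot$ and ${\downarrow}$ and inner nodes $\sigma_n$ ($\sigma\in\Sigma$, $n\in\mathbb N$) with children indexed by $\mathbb N$. It is ordered by: $tr_1\le tr_2$ iff $tr_1$ is obtained from $tr_2$ by replacing subtrees by $\bot$; this is an $\omega$-cpo. For a closed computation $t$ put $[\![t]\!]_0=\bot$ and let $[\![t]\!]_{n+1}$ be $[\![s]\!]_n$ if $t\to s$; $\sigma_m([\![s[\overline k/x]]\!]_n)_{k\in\mathbb N}$ if $t=\sigma(\overline m,x.s)$; and ${\downarrow}$ if $t={\downarrow}$. Let $[\![t]\!]=\bigsqcup_n[\![t]\!]_n$. **Observations.** A set of observations $\mathfrak P$ is a set of subsets of $\mathit{Trees}_\Sigma$. A set $X$ of trees is *Scott-open* if it is upwards closed and every ascending chain $tr_0\le tr_1\le\cdots$ with $\bigsqcup_i tr_i\in X$ has some $tr_j\in X$. $\mathfrak P$ is *decomposable* if for all $P\in\mathfrak P$ and $\sigma_n(tr_0,tr_1,\ldots)\in P$ there are $P_0,P_1,\ldots\in\mathfrak P$ with $tr_k\in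 P_k$ for all $k$, such that $\sigma_n(p_0,p_1,\ldots)\in P$ whenever $p_k\in P_k$ for all $k$. $\mathfrak P$ is *consistent* if there are $P_0\in\mathfrak P$ with $P_0\neq\mathit{Trees}_\Sigma$ and a closed computation $t_0$ with $[\![t_0]\!]\in P_0$. **Bisimilarity.** A well-typed relation $\mathcal R$ on closed terms consists of a relation $\mathcal R^{\mathfrak v}_A$ on the closed values of type $A$, for each type $A$, and a relation $\mathcal R^{\mathfrak c}$ on closed computations. It is an *applicative $\mathfrak P$-simulation* if (1) $v\,\mathcal R^{\mathfrak v}_{\mathtt{unit}}\,w$ implies $v=w=\star$; (2) $v\,\mathcal R^{\mathfrak v}_{\mathtt{nat}}\,w$ implies $v=w$; (3) $s\,\mathcal R^{\mathfrak c}\,t$ implies that for all $P\in\mathfrak P$, if $[\![s]\!]\in P$ then $[\![t]\!]\in P$; (4) $v\,\mathcal R^{\mathfrak v}_{\neg(A_1,\ldots,A_n)}\,u$ implies $v(\overrightarrow w)\,\mathcal R^{\mathfrak c}\,u(\overrightarrow w)$ for all closed $w_i:A_i$. An *applicative $\mathfrak P$-bisimulation* is a symmetric applicative $\mathfrak P$-simulation.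 *Applicative $\mathfrak P$-similarity* $\precsim$ and *applicative $\mathfrak P$-bisimilarity* $\sim$ are the unions of all applicative $\mathfrak P$-simulations and $\mathfrak P$-bisimulations, respectively. The *open extension* $\mathcal R^\circ$ of $\mathcal R$ relates two terms over the context $\overrightarrow{x_i:A_i}$ (computations, or values of the same type) iff $\mathcal R$ relates their instances under $[\overrightarrow{u_i/x_i}]$ for all closed values $u_i:A_i$. **Contextual preorder and equivalence.** A well-typed relation $\mathcal R$ on possibly open terms relates, for each context $\Gamma$, values of the same type over $\Gamma$ and computations over $\Gamma$. It is *compatible* if it is closed under all the term constructors of the language (in particular it relates each variable, $\star$, $\mathtt{zero}$ and ${\downarrow}$ to itself). It is *$\mathfrak P$-adequate* (respectively *$\mathfrak P$-biadequate*) if for all closed computations $s,t$ with $\vdash s\,\mathcal R^{\mathfrak c}\,t$ and all $P\in\mathfrak P$: $[\![s]\!]\in P$ implies $[\![t]\!]\in P$ (respectively, $[\![s]\!]\in P$ iff $[\![t]\!]\in P$). The *contextual preorder* $\sqsubseteq_{\mathrm{ctx}}$ is the union of all compatible $\mathfrak P$-adequate relations, and *contextual equivalence* $\equiv_{\mathrm{ctx}}$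 is the union of all compatible $\mathfrak P$-biadequate relations. **Theorem.** Let $\mathfrak P$ be a decomposable and consistent set of Scott-open observations. Then: 1. the open extension $\precsim^\circ$ of applicative $\mathfrak P$-similarity coincides with the contextual preorder $\sqsubseteq_{\mathrm{ctx}}$; 2. the open extension $\sim^\circ$ of applicative $\mathfrak P$-bisimilarity coincides with contextual equivalence $\equiv_{\mathrm{ctx}}$. -/

import Mathlib

namespace ECPS

universe u

/-! ### Types, typing contexts and variables -/

/-- The types `A ::= ¬(A₁,…,Aₙ) | nat | unit`. -/
inductive Ty : Type
  | neg : List Ty → Ty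
  | nat : Ty
  | unit : Ty

/-- Typing contexts. Terms are taken up to `α`-conversion (de Bruijn representation), so a context is
just the list of the types of its variables, the most recently bound ones first; the simultaneously
bound parameters `x₁,…,xₙ` of an abstraction are listed in this order. -/
abbrev Ctx : Type := List Ty

/-- `Var Γ A`: the variables (positions) of type `A` in the context `Γ`. -/
inductive Var : Ctx → Ty → Type
  | here {Γ : Ctx} {A : Ty} : Var (A :: Γ) A
  | there {Γ : Ctx} {A B : Ty} : Var Γ A → Var (B :: Γ) A

/-! ### Terms

Well-typed terms, up to `α`-conversion: the constructors are exactly the typing rules. Since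
`λ`-abstractions carry the types of their parameters, a typable term has exactly one typing derivation
in a given context (and at most one type), so these are the same thing as typable raw terms. -/

mutual

/-- `Val Op Γ A`: the values `v` with `Γ ⊢ v : A`, for the set `Op` of effect operations. -/
inductive Val (Op : Type u) : Ctx → Ty → Type u
  | var {Γ : Ctx} {A : Ty} : Var Γ A → Val Op Γ A
  | zero {Γ : Ctx} : Val Op Γ Ty.nat
  | succ {Γ : Ctx} : Val Op Γ Ty.nat → Val Op Γ Ty.nat
  | star {Γ : Ctx} : Val Op Γ Ty.unit
  /-- `λ(x₁,…,xₙ):(A₁,…,Aₙ). t` -/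
  | lam {Γ : Ctx} (As : List Ty) : Comp Op (As ++ Γ) → Val Op Γ (Ty.neg As)

/-- `Comp Op Γ`: the computations `t` with `Γ ⊢ t`. An argument tuple `(w₁,…,wₙ)` of types
`(A₁,…,Aₙ)` is given as a function that sends the position of each `Aᵢ` to the value `wᵢ`. -/
inductive Comp (Op : Type u) : Ctx → Type u
  /-- `v(w₁,…,wₙ)` -/
  | app {Γ : Ctx} {As : List Ty} :
      Val Op Γ (Ty.neg As) → (∀ A : Ty, Var As A → Val Op Γ A) → Comp Op Γ
  /-- `(μx.v)(w₁,…,wₙ)` -/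
  | mu {Γ : Ctx} {As : List Ty} :
      Val Op (Ty.neg As :: Γ) (Ty.neg As) → (∀ A : Ty, Var As A → Val Op Γ A) → Comp Op Γ
  /-- `σ(v, x.t)` -/
  | op {Γ : Ctx} : Op → Val Op Γ Ty.nat → Comp Op (Ty.nat :: Γ) → Comp Op Γ
  /-- `↓` -/
  | halt {Γ : Ctx} : Comp Op Γ
  /-- `case v in {zero ⇒ s, succ(x) ⇒ t}` -/
  | caseOf {Γ : Ctx} :
      Val Op Γ Ty.nat → Comp Op Γ → Comp Op (Ty.nat :: Γ) → Comp Op Γ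

end

/-! ### Renaming and substitution -/

/-- Renamings: maps from the variables of `Γ` to the variables of `Δ`, preserving types. -/
abbrev Ren (Γ Δ : Ctx) : Type := ∀ A : Ty, Var Γ A → Var Δ A

/-- Simultaneous substitutions of values over `Δ` for the variables of `Γ`. These are also the
tuples of values over `Δ` whose types are listed by `Γ`. -/
abbrev Sub (Op : Type u) (Γ Δ : Ctx) : Type u := ∀ A : Ty, Var Γ A → Val Op Δ A

/-- Extend a renaming by a bound variable. -/
def Ren.lift₁ {Γ Δ : Ctx} (ρ : Ren Γ Δ) (B : Ty) : Ren (B :: Γ) (B :: Δ)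
  | _, Var.here => Var.here
  | _, Var.there x => Var.there (ρ _ x)

/-- Extend a renaming by several bound variables. -/
def Ren.lift {Γ Δ : Ctx} (ρ : Ren Γ Δ) : (Bs : List Ty) → Ren (Bs ++ Γ) (Bs ++ Δ)
  | [] => ρ
  | B :: Bs => Ren.lift₁ (Ren.lift ρ Bs) B

/-- The inclusion of the variables of `Γ` into `Bs ++ Γ`. -/
def Ren.weaken {Γ : Ctx} : (Bs : List Ty) → Ren Γ (Bs ++ Γ)
  | [] => fun _ x => x
  | _ :: Bs => fun A x => Var.there (Ren.weaken Bs A x)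

/-- The inclusion of the variables of `Bs` into `Bs ++ Γ`. -/
def Ren.inl {Γ : Ctx} : (Bs : List Ty) → Ren Bs (Bs ++ Γ)
  | _ :: _, _, Var.here => Var.here
  | _ :: Bs, A, Var.there x => Var.there (Ren.inl Bs A x)

mutual

def Val.rename {Op : Type u} : {Γ : Ctx} → {A : Ty} → Val Op Γ A → {Δ : Ctx} → Ren Γ Δ → Val Op Δ A
  | _, _, Val.var x, _, ρ => Val.var (ρ _ x)
  | _, _, Val.zero, _, _ => Val.zero
  | _, _, Val.succ v, _, ρ => Val.succ (v.rename ρ)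
  | _, _, Val.star, _, _ => Val.star
  | _, _, Val.lam As t, _, ρ => Val.lam As (t.rename (ρ.lift As))

def Comp.rename {Op : Type u} : {Γ : Ctx} → Comp Op Γ → {Δ : Ctx} → Ren Γ Δ → Comp Op Δ
  | _, Comp.app v ws, _, ρ => Comp.app (v.rename ρ) (fun A x => (ws A x).rename ρ)
  | _, Comp.mu v ws, _, ρ => Comp.mu (v.rename (ρ.lift₁ _)) (fun A x => (ws A x).rename ρ)
  | _, Comp.op σ v t, _, ρ => Comp.op σ (v.rename ρ) (t.rename (ρ.lift₁ _))
  | _, Comp.halt, _, _ => Comp.halt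
  | _, Comp.caseOf v s t, _, ρ => Comp.caseOf (v.rename ρ) (s.rename ρ) (t.rename (ρ.lift₁ _))

end

/-- Extend a substitution by a bound variable. -/
def Sub.lift₁ {Op : Type u} {Γ Δ : Ctx} (θ : Sub Op Γ Δ) (B : Ty) : Sub Op (B :: Γ) (B :: Δ)
  | _, Var.here => Val.var Var.here
  | _, Var.there x => (θ _ x).rename (fun _ y => Var.there y)

/-- Extend a substitution by several bound variables. -/
def Sub.lift {Op : Type u} {Γ Δ : Ctx} (θ : Sub Op Γ Δ) :
    (Bs : List Ty) → Sub Op (Bs ++ Γ) (Bs ++ Δ)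
  | [] => θ
  | B :: Bs => Sub.lift₁ (Sub.lift θ Bs) B

mutual

/-- Capture-avoiding simultaneous substitution in values. -/
def Val.subst {Op : Type u} : {Γ : Ctx} → {A : Ty} → Val Op Γ A → {Δ : Ctx} → Sub Op Γ Δ → Val Op Δ A
  | _, _, Val.var x, _, θ => θ _ x
  | _, _, Val.zero, _, _ => Val.zero
  | _, _, Val.succ v, _, θ => Val.succ (v.subst θ)
  | _, _, Val.star, _, _ => Val.star
  | _, _, Val.lam As t, _, θ => Val.lam As (t.subst (Sub.lift θ As))

/-- Capture-avoiding simultaneous substitution in computations. -/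
def Comp.subst {Op : Type u} : {Γ : Ctx} → Comp Op Γ → {Δ : Ctx} → Sub Op Γ Δ → Comp Op Δ
  | _, Comp.app v ws, _, θ => Comp.app (v.subst θ) (fun A x => (ws A x).subst θ)
  | _, Comp.mu v ws, _, θ => Comp.mu (v.subst (Sub.lift₁ θ _)) (fun A x => (ws A x).subst θ)
  | _, Comp.op σ v t, _, θ => Comp.op σ (v.subst θ) (t.subst (Sub.lift₁ θ _))
  | _, Comp.halt, _, _ => Comp.halt
  | _, Comp.caseOf v s t, _, θ =>
      Comp.caseOf (v.subst θ) (s.subst θ) (t.subst (Sub.lift₁ θ _))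

end

/-- The substitution `[w/x]` for the last variable of `B :: Γ`. -/
def Sub.single {Op : Type u} {Γ : Ctx} {B : Ty} (w : Val Op Γ B) : Sub Op (B :: Γ) Γ
  | _, Var.here => w
  | _, Var.there x => Val.var x

/-- The substitution `[w₁/x₁,…,wₙ/xₙ]` for the last `n` variables of `Bs ++ Γ`. -/
def Sub.inst {Op : Type u} {Γ : Ctx} : (Bs : List Ty) → Sub Op Bs Γ → Sub Op (Bs ++ Γ) Γ
  | [], _ => fun _ x => Val.var x
  | _ :: _, ws => fun
    | _, Var.here => ws _ Var.here
    | _, Var.there x => Sub.inst _ (fun _ y => ws _ (Var.there y)) _ x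

/-! ### Operational semantics -/

/-- The numeral `succⁿ(zero)`. -/
def numeral (Op : Type u) {Γ : Ctx} : ℕ → Val Op Γ Ty.nat
  | 0 => Val.zero
  | n + 1 => Val.succ (numeral Op n)

/-- The number `m` such that a closed value of type `nat` is the numeral of `m`. (For other values,
where it is not used, this is the number of leading `succ`s.) -/
def Val.toNat {Op : Type u} : {Γ : Ctx} → {A : Ty} → Val Op Γ A → ℕ
  | _, _, Val.succ v => v.toNat + 1
  | _, _, _ => 0

theorem numeral_toNat {Op : Type u} : ∀ v : Val Op [] Ty.nat, numeral Op v.toNat = v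
  | Val.zero => rfl
  | Val.succ v => congrArg Val.succ (numeral_toNat v)

/-- The value `λ(y₁,…,yₙ):(A₁,…,Aₙ). (μx.v)(y₁,…,yₙ)`. -/
def muFun {Op : Type u} {Γ : Ctx} {As : List Ty}
    (v : Val Op (Ty.neg As :: Γ) (Ty.neg As)) : Val Op Γ (Ty.neg As) :=
  Val.lam As (Comp.mu (v.rename ((Ren.weaken As).lift₁ _)) (fun A x => Val.var (Ren.inl As A x)))

/-- What a closed computation does next: a reduction `t ⟶ s`, an effect `t ⟶ (sₖ)ₖ` labelled by
`σ(m)`, or termination. -/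
inductive Next (Op : Type u) : Type u
  | step : Comp Op [] → Next Op
  | effect : Op → ℕ → (ℕ → Comp Op []) → Next Op
  | halted : Next Op

/-- The (deterministic) operational semantics of closed computations. -/
def Comp.next {Op : Type u} : Comp Op [] → Next Op
  | Comp.app (Val.lam As t) ws => Next.step (t.subst (Sub.inst As ws))
  | Comp.mu v ws => Next.step (Comp.app (v.subst (Sub.single (muFun v))) ws)
  | Comp.op σ v t => Next.effect σ v.toNat (fun k => t.subst (Sub.single (numeral Op k)))
  | Comp.halt => Next.halted
  | Comp.caseOf Val.zero s _ => Next.step s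
  | Comp.caseOf (Val.succ v) _ t => Next.step (t.subst (Sub.single v))

/-! ### Effect trees -/

/-- Labels of the vertices of an effect tree: leaves `⊥` and `↓`, inner nodes `σₙ`. -/
inductive Label (Op : Type u) : Type u
  | bot : Label Op
  | down : Label Op
  | op : Op → ℕ → Label Op

/-- Effect trees, of possibly infinite depth, in which every inner node has children `0, 1, 2, …`.
A tree is given by the label of the vertex reached from the root along each finite path; paths that
run past a leaf are labelled `⊥` by convention, which makes the representation unique. -/
@[ext]
structure Tree (Op : Type u) : Type u where
  label : List ℕ → Label Op
  label_of_leaf : ∀ (p : List ℕ) (k : ℕ),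
    (∀ (σ : Op) (n : ℕ), label p ≠ Label.op σ n) → label (p ++ [k]) = Label.bot

namespace Tree

variable {Op : Type u}

/-- The leaf `⊥`. -/
instance : Bot (Tree Op) := ⟨⟨fun _ => Label.bot, fun _ _ _ => rfl⟩⟩

/-- The leaf `↓`. -/
def down : Tree Op where
  label
    | [] => Label.down
    | _ :: _ => Label.bot
  label_of_leaf p k _ := by cases p <;> rfl

/-- The tree `σₙ(tr₀, tr₁, …)`. -/
def node (σ : Op) (n : ℕ) (tr : ℕ → Tree Op) : Tree Op where
  label
    | [] => Label.op σ n
    | k :: p => (tr k).label p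
  label_of_leaf p k h := by
    cases p with
    | nil => exact absurd rfl (h σ n)
    | cons j p => exact (tr j).label_of_leaf p k h

/-- `tr₁ ≤ tr₂` iff `tr₁` is obtained from `tr₂` by replacing subtrees by `⊥`: wherever the vertex
of `tr₁` is not `⊥`, it has the same label in `tr₂`. -/
instance : PartialOrder (Tree Op) where
  le a b := ∀ p : List ℕ, a.label p = Label.bot ∨ a.label p = b.label p
  le_refl _ _ := Or.inr rfl
  le_trans a b c hab hbc p := by
    rcases hab p with h | h
    · exact Or.inl h
    · rw [h]; exact hbc p
  le_antisymm a b hab hba := by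
    ext p : 2
    rcases hab p with h | h
    · rcases hba p with h' | h'
      · rw [h, h']
      · exact h'.symm
    · exact h

theorem bot_le' (a : Tree Op) : ⊥ ≤ a := fun _ => Or.inl rfl

theorem node_mono {σ : Op} {n : ℕ} {a b : ℕ → Tree Op} (h : ∀ k, a k ≤ b k) :
    node σ n a ≤ node σ n b
  | [] => Or.inr rfl
  | k :: p => h k p

theorem label_chain (c : ℕ →o Tree Op) {m n : ℕ} {p : List ℕ}
    (hm : (c m).label p ≠ Label.bot) (hn : (c n).label p ≠ Label.bot) :
    (c m).label p = (c n).label p := by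
  rcases le_total m n with h | h
  · exact (c.monotone h p).resolve_left hm
  · exact ((c.monotone h p).resolve_left hn).symm

open Classical in
/-- The label of the supremum of a chain at a vertex: the common value of the labels other than `⊥`
occurring there in the chain, if there are any. -/
noncomputable def supLabel (c : ℕ →o Tree Op) (p : List ℕ) : Label Op :=
  if h : ∃ n, (c n).label p ≠ Label.bot then (c h.choose).label p else Label.bot

theorem supLabel_eq (c : ℕ →o Tree Op) {n : ℕ} {p : List ℕ} (hn : (c n).label p ≠ Label.bot) :
    supLabel c p = (c n).label p := by
  have h : ∃ n, (c n).label p ≠ Label.bot := ⟨n, hn⟩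
  rw [supLabel, dif_pos h]
  exact label_chain c h.choose_spec hn

theorem supLabel_bot (c : ℕ →o Tree Op) {p : List ℕ} (h : ∀ n, (c n).label p = Label.bot) :
    supLabel c p = Label.bot := by
  rw [supLabel, dif_neg]
  rintro ⟨n, hn⟩
  exact hn (h n)

/-- The supremum of an ascending chain of trees. -/
noncomputable def sup (c : ℕ →o Tree Op) : Tree Op where
  label := supLabel c
  label_of_leaf p k h := by
    apply supLabel_bot
    intro n
    apply (c n).label_of_leaf
    intro σ m hσ
    have hne : (c n).label p ≠ Label.bot := by rw [hσ]; intro hc; cases hc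
    exact h σ m ((supLabel_eq c hne).trans hσ)

/-- Effect trees form an `ω`-complete partial order. -/
noncomputable instance : OmegaCompletePartialOrder (Tree Op) where
  ωSup c := sup c.toOrderHom
  le_ωSup c n p := by
    by_cases h : (c n).label p = Label.bot
    · exact Or.inl h
    · exact Or.inr (supLabel_eq c.toOrderHom h).symm
  ωSup_le c a ha p := by
    by_cases h : ∀ n, (c n).label p = Label.bot
    · exact Or.inl (supLabel_bot c.toOrderHom h)
    · push Not at h
      obtain ⟨n, hn⟩ := h
      right
      exact (supLabel_eq c.toOrderHom hn).trans ((ha n p).resolve_left hn)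

end Tree

/-! ### Computation trees -/

/-- `treeN n t`: the effect tree of the closed computation `t` after `n` steps of unfolding. -/
def treeN {Op : Type u} : ℕ → Comp Op [] → Tree Op
  | 0, _ => ⊥
  | n + 1, t =>
    match t.next with
    | Next.step s => treeN n s
    | Next.effect σ m s => Tree.node σ m (fun k => treeN n (s k))
    | Next.halted => Tree.down

theorem treeN_le_succ {Op : Type u} (n : ℕ) : ∀ t : Comp Op [], treeN n t ≤ treeN (n + 1) t := by
  induction n with
  | zero => exact fun t => Tree.bot_le' _
  | succ n ih =>
    intro t
    rw [treeN, treeN]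
    cases t.next with
    | step s => exact ih s
    | effect σ m s => exact Tree.node_mono fun k => ih (s k)
    | halted => exact le_refl _

/-- The computation tree of a closed computation: the least upper bound of the chain of its finite
unfoldings. -/
noncomputable def tree {Op : Type u} (t : Comp Op []) : Tree Op :=
  OmegaCompletePartialOrder.ωSup
    ⟨⟨fun n => treeN n t, monotone_nat_of_le_succ fun n => treeN_le_succ n t⟩⟩

/-! ### Observations -/

/-- Scott-openness of a set of trees. -/
def ScottOpen {Op : Type u} (X : Set (Tree Op)) : Prop :=
  (∀ a b : Tree Op, a ∈ X → a ≤ b → b ∈ X) ∧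
  ∀ c : ℕ → Tree Op, Monotone c → ∀ a : Tree Op, IsLUB (Set.range c) a → a ∈ X → ∃ j, c j ∈ X

/-- Decomposability of a set of observations. -/
def Decomposable {Op : Type u} (Obs : Set (Set (Tree Op))) : Prop :=
  ∀ P ∈ Obs, ∀ (σ : Op) (n : ℕ) (tr : ℕ → Tree Op), Tree.node σ n tr ∈ P →
    ∃ P' : ℕ → Set (Tree Op), (∀ k, P' k ∈ Obs) ∧ (∀ k, tr k ∈ P' k) ∧
      ∀ p : ℕ → Tree Op, (∀ k, p k ∈ P' k) → Tree.node σ n p ∈ P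

/-- Consistency of a set of observations. -/
def Consistent {Op : Type u} (Obs : Set (Set (Tree Op))) : Prop :=
  ∃ P₀ ∈ Obs, P₀ ≠ Set.univ ∧ ∃ t₀ : Comp Op [], tree t₀ ∈ P₀

/-! ### Well-typed relations -/

/-- Well-typed relations on closed terms. -/
@[ext]
structure ClosedRel (Op : Type u) : Type u where
  val : ∀ A : Ty, Val Op [] A → Val Op [] A → Prop
  comp : Comp Op [] → Comp Op [] → Prop

/-- Well-typed relations on possibly open terms. -/
@[ext]
structure OpenRel (Op : Type u) : Type u where
  val : ∀ (Γ : Ctx) (A : Ty), Val Op Γ A → Val Op Γ A → Prop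
  comp : ∀ Γ : Ctx, Comp Op Γ → Comp Op Γ → Prop

/-- The open extension of a relation on closed terms: relate two open terms if all their closed
instances are related. -/
def ClosedRel.openExt {Op : Type u} (R : ClosedRel Op) : OpenRel Op where
  val Γ A v w := ∀ θ : Sub Op Γ [], R.val A (v.subst θ) (w.subst θ)
  comp Γ s t := ∀ θ : Sub Op Γ [], R.comp (s.subst θ) (t.subst θ)

/-! ### Applicative similarity and bisimilarity -/

/-- Applicative simulations for the set of observations `Obs`. -/
structure IsSimulation {Op : Type u} (Obs : Set (Set (Tree Op))) (R : ClosedRel Op) : Prop where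
  unit : ∀ v w : Val Op [] Ty.unit, R.val Ty.unit v w → v = Val.star ∧ w = Val.star
  nat : ∀ v w : Val Op [] Ty.nat, R.val Ty.nat v w → v = w
  comp : ∀ s t : Comp Op [], R.comp s t → ∀ P ∈ Obs, tree s ∈ P → tree t ∈ P
  neg : ∀ (As : List Ty) (v u : Val Op [] (Ty.neg As)), R.val (Ty.neg As) v u →
    ∀ ws : Sub Op As [], R.comp (Comp.app v ws) (Comp.app u ws)

/-- Applicative bisimulations: symmetric applicative simulations. -/
structure IsBisimulation {Op : Type u} (Obs : Set (Set (Tree Op))) (R : ClosedRel Op) : Prop where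
  isSimulation : IsSimulation Obs R
  symm_val : ∀ (A : Ty) (v w : Val Op [] A), R.val A v w → R.val A w v
  symm_comp : ∀ s t : Comp Op [], R.comp s t → R.comp t s

/-- Applicative similarity: the union of all applicative simulations. -/
def similarity {Op : Type u} (Obs : Set (Set (Tree Op))) : ClosedRel Op where
  val A v w := ∃ R : ClosedRel Op, IsSimulation Obs R ∧ R.val A v w
  comp s t := ∃ R : ClosedRel Op, IsSimulation Obs R ∧ R.comp s t

/-- Applicative bisimilarity: the union of all applicative bisimulations. -/
def bisimilarity {Op : Type u} (Obs : Set (Set (Tree Op))) : ClosedRel Op where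
  val A v w := ∃ R : ClosedRel Op, IsBisimulation Obs R ∧ R.val A v w
  comp s t := ∃ R : ClosedRel Op, IsBisimulation Obs R ∧ R.comp s t

/-! ### Contextual preorder and contextual equivalence -/

/-- Compatibility: closure under all term constructors. -/
structure Compatible {Op : Type u} (R : OpenRel Op) : Prop where
  var : ∀ (Γ : Ctx) (A : Ty) (x : Var Γ A), R.val Γ A (Val.var x) (Val.var x)
  star : ∀ Γ : Ctx, R.val Γ Ty.unit Val.star Val.star
  lam : ∀ (Γ : Ctx) (As : List Ty) (s t : Comp Op (As ++ Γ)),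
    R.comp (As ++ Γ) s t → R.val Γ (Ty.neg As) (Val.lam As s) (Val.lam As t)
  zero : ∀ Γ : Ctx, R.val Γ Ty.nat Val.zero Val.zero
  succ : ∀ (Γ : Ctx) (v v' : Val Op Γ Ty.nat),
    R.val Γ Ty.nat v v' → R.val Γ Ty.nat (Val.succ v) (Val.succ v')
  app : ∀ (Γ : Ctx) (As : List Ty) (v v' : Val Op Γ (Ty.neg As)) (ws ws' : Sub Op As Γ),
    R.val Γ (Ty.neg As) v v' → (∀ (A : Ty) (x : Var As A), R.val Γ A (ws A x) (ws' A x)) →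
      R.comp Γ (Comp.app v ws) (Comp.app v' ws')
  mu : ∀ (Γ : Ctx) (As : List Ty) (v v' : Val Op (Ty.neg As :: Γ) (Ty.neg As))
    (ws ws' : Sub Op As Γ),
    R.val (Ty.neg As :: Γ) (Ty.neg As) v v' →
    (∀ (A : Ty) (x : Var As A), R.val Γ A (ws A x) (ws' A x)) →
      R.comp Γ (Comp.mu v ws) (Comp.mu v' ws')
  op : ∀ (Γ : Ctx) (σ : Op) (v v' : Val Op Γ Ty.nat) (t t' : Comp Op (Ty.nat :: Γ)),
    R.val Γ Ty.nat v v' → R.comp (Ty.nat :: Γ) t t' →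
      R.comp Γ (Comp.op σ v t) (Comp.op σ v' t')
  halt : ∀ Γ : Ctx, R.comp Γ Comp.halt Comp.halt
  caseOf : ∀ (Γ : Ctx) (v v' : Val Op Γ Ty.nat) (s s' : Comp Op Γ) (t t' : Comp Op (Ty.nat :: Γ)),
    R.val Γ Ty.nat v v' → R.comp Γ s s' → R.comp (Ty.nat :: Γ) t t' →
      R.comp Γ (Comp.caseOf v s t) (Comp.caseOf v' s' t')

/-- Adequacy with respect to the set of observations `Obs`. -/
def Adequate {Op : Type u} (Obs : Set (Set (Tree Op))) (R : OpenRel Op) : Prop :=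
  ∀ s t : Comp Op [], R.comp [] s t → ∀ P ∈ Obs, tree s ∈ P → tree t ∈ P

/-- Biadequacy with respect to the set of observations `Obs`. -/
def Biadequate {Op : Type u} (Obs : Set (Set (Tree Op))) (R : OpenRel Op) : Prop :=
  ∀ s t : Comp Op [], R.comp [] s t → ∀ P ∈ Obs, (tree s ∈ P ↔ tree t ∈ P)

/-- The contextual preorder: the union of all compatible adequate relations. -/
def contextualPreorder {Op : Type u} (Obs : Set (Set (Tree Op))) : OpenRel Op where
  val Γ A v w := ∃ R : OpenRel Op, Compatible R ∧ Adequate Obs R ∧ R.val Γ A v w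
  comp Γ s t := ∃ R : OpenRel Op, Compatible R ∧ Adequate Obs R ∧ R.comp Γ s t

/-- Contextual equivalence: the union of all compatible biadequate relations. -/
def contextualEquivalence {Op : Type u} (Obs : Set (Set (Tree Op))) : OpenRel Op where
  val Γ A v w := ∃ R : OpenRel Op, Compatible R ∧ Biadequate Obs R ∧ R.val Γ A v w
  comp Γ s t := ∃ R : OpenRel Op, Compatible R ∧ Biadequate Obs R ∧ R.comp Γ s t

end ECPS

namespace ECPS

universe u

variable {Op : Type u}

/-! ### The algebra of renamings and substitutions -/

theorem Ren.lift₁_comp {Γ Δ Θ : Ctx} (ρ : Ren Γ Δ) (ρ' : Ren Δ Θ) (B : Ty) :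
    (fun A x => ρ'.lift₁ B A (ρ.lift₁ B A x)) = Ren.lift₁ (fun A x => ρ' A (ρ A x)) B := by
  funext A x
  cases x <;> rfl

theorem Ren.lift_comp {Γ Δ Θ : Ctx} (ρ : Ren Γ Δ) (ρ' : Ren Δ Θ) (Bs : List Ty) :
    (fun A x => ρ'.lift Bs A (ρ.lift Bs A x)) = Ren.lift (fun A x => ρ' A (ρ A x)) Bs := by
  induction Bs with
  | nil => rfl
  | cons B Bs ih => exact (Ren.lift₁_comp _ _ B).trans (congrArg (Ren.lift₁ · B) ih)

mutual

theorem Val.rename_rename : {Γ : Ctx} → {A : Ty} → (v : Val Op Γ A) → {Δ Θ : Ctx} →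
    (ρ : Ren Γ Δ) → (ρ' : Ren Δ Θ) →
    (v.rename ρ).rename ρ' = v.rename (fun A x => ρ' A (ρ A x))
  | _, _, Val.var x, _, _, ρ, ρ' => by simp only [Val.rename]
  | _, _, Val.zero, _, _, ρ, ρ' => by simp only [Val.rename]
  | _, _, Val.succ v, _, _, ρ, ρ' => by simp only [Val.rename, v.rename_rename]
  | _, _, Val.star, _, _, ρ, ρ' => by simp only [Val.rename]
  | _, _, Val.lam As t, _, _, ρ, ρ' => by
    simp only [Val.rename, t.rename_rename, Ren.lift_comp]

theorem Comp.rename_rename : {Γ : Ctx} → (t : Comp Op Γ) → {Δ Θ : Ctx} →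
    (ρ : Ren Γ Δ) → (ρ' : Ren Δ Θ) →
    (t.rename ρ).rename ρ' = t.rename (fun A x => ρ' A (ρ A x))
  | _, Comp.app v ws, _, _, ρ, ρ' => by
    simp only [Comp.rename, v.rename_rename, fun A x => (ws A x).rename_rename ρ ρ']
  | _, Comp.mu v ws, _, _, ρ, ρ' => by
    simp only [Comp.rename, v.rename_rename, fun A x => (ws A x).rename_rename ρ ρ', Ren.lift₁_comp]
  | _, Comp.op σ v t, _, _, ρ, ρ' => by
    simp only [Comp.rename, v.rename_rename, t.rename_rename, Ren.lift₁_comp]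
  | _, Comp.halt, _, _, ρ, ρ' => by simp only [Comp.rename]
  | _, Comp.caseOf v s t, _, _, ρ, ρ' => by
    simp only [Comp.rename, v.rename_rename, s.rename_rename, t.rename_rename, Ren.lift₁_comp]

end

theorem Sub.lift₁_rename {Γ Δ Θ : Ctx} (ρ : Ren Γ Δ) (θ : Sub Op Δ Θ) (B : Ty) :
    (fun A x => θ.lift₁ B A (ρ.lift₁ B A x)) = Sub.lift₁ (fun A x => θ A (ρ A x)) B := by
  funext A x
  cases x <;> rfl

theorem Sub.lift_rename {Γ Δ Θ : Ctx} (ρ : Ren Γ Δ) (θ : Sub Op Δ Θ) (Bs : List Ty) :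
    (fun A x => θ.lift Bs A (ρ.lift Bs A x)) = Sub.lift (fun A x => θ A (ρ A x)) Bs := by
  induction Bs with
  | nil => rfl
  | cons B Bs ih => exact (Sub.lift₁_rename _ _ B).trans (congrArg (Sub.lift₁ · B) ih)

mutual

theorem Val.subst_rename : {Γ : Ctx} → {A : Ty} → (v : Val Op Γ A) → {Δ Θ : Ctx} →
    (ρ : Ren Γ Δ) → (θ : Sub Op Δ Θ) →
    (v.rename ρ).subst θ = v.subst (fun A x => θ A (ρ A x))
  | _, _, Val.var x, _, _, ρ, θ => by simp only [Val.rename, Val.subst]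
  | _, _, Val.zero, _, _, ρ, θ => by simp only [Val.rename, Val.subst]
  | _, _, Val.succ v, _, _, ρ, θ => by simp only [Val.rename, Val.subst, v.subst_rename]
  | _, _, Val.star, _, _, ρ, θ => by simp only [Val.rename, Val.subst]
  | _, _, Val.lam As t, _, _, ρ, θ => by
    simp only [Val.rename, Val.subst, t.subst_rename, Sub.lift_rename]

theorem Comp.subst_rename : {Γ : Ctx} → (t : Comp Op Γ) → {Δ Θ : Ctx} →
    (ρ : Ren Γ Δ) → (θ : Sub Op Δ Θ) →
    (t.rename ρ).subst θ = t.subst (fun A x => θ A (ρ A x))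
  | _, Comp.app v ws, _, _, ρ, θ => by
    simp only [Comp.rename, Comp.subst, v.subst_rename, fun A x => (ws A x).subst_rename ρ θ]
  | _, Comp.mu v ws, _, _, ρ, θ => by
    simp only [Comp.rename, Comp.subst, v.subst_rename, fun A x => (ws A x).subst_rename ρ θ,
      Sub.lift₁_rename]
  | _, Comp.op σ v t, _, _, ρ, θ => by
    simp only [Comp.rename, Comp.subst, v.subst_rename, t.subst_rename, Sub.lift₁_rename]
  | _, Comp.halt, _, _, ρ, θ => by simp only [Comp.rename, Comp.subst]
  | _, Comp.caseOf v s t, _, _, ρ, θ => by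
    simp only [Comp.rename, Comp.subst, v.subst_rename, s.subst_rename, t.subst_rename,
      Sub.lift₁_rename]

end

theorem Sub.rename_lift₁ {Γ Δ Θ : Ctx} (θ : Sub Op Γ Δ) (ρ : Ren Δ Θ) (B : Ty) :
    (fun A x => (θ.lift₁ B A x).rename (ρ.lift₁ B)) =
      Sub.lift₁ (fun A x => (θ A x).rename ρ) B := by
  funext A x
  cases x with
  | here => simp only [Sub.lift₁, Val.rename, Ren.lift₁]
  | there x => simp only [Sub.lift₁, Val.rename_rename, Ren.lift₁]

theorem Sub.rename_lift {Γ Δ Θ : Ctx} (θ : Sub Op Γ Δ) (ρ : Ren Δ Θ) (Bs : List Ty) :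
    (fun A x => (θ.lift Bs A x).rename (ρ.lift Bs)) =
      Sub.lift (fun A x => (θ A x).rename ρ) Bs := by
  induction Bs with
  | nil => rfl
  | cons B Bs ih => exact (Sub.rename_lift₁ _ _ B).trans (congrArg (Sub.lift₁ · B) ih)

mutual

theorem Val.rename_subst : {Γ : Ctx} → {A : Ty} → (v : Val Op Γ A) → {Δ Θ : Ctx} →
    (θ : Sub Op Γ Δ) → (ρ : Ren Δ Θ) →
    (v.subst θ).rename ρ = v.subst (fun A x => (θ A x).rename ρ)
  | _, _, Val.var x, _, _, θ, ρ => by simp only [Val.subst]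
  | _, _, Val.zero, _, _, θ, ρ => by simp only [Val.rename, Val.subst]
  | _, _, Val.succ v, _, _, θ, ρ => by simp only [Val.rename, Val.subst, v.rename_subst]
  | _, _, Val.star, _, _, θ, ρ => by simp only [Val.rename, Val.subst]
  | _, _, Val.lam As t, _, _, θ, ρ => by
    simp only [Val.rename, Val.subst, t.rename_subst, Sub.rename_lift]

theorem Comp.rename_subst : {Γ : Ctx} → (t : Comp Op Γ) → {Δ Θ : Ctx} →
    (θ : Sub Op Γ Δ) → (ρ : Ren Δ Θ) →
    (t.subst θ).rename ρ = t.subst (fun A x => (θ A x).rename ρ)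
  | _, Comp.app v ws, _, _, θ, ρ => by
    simp only [Comp.rename, Comp.subst, v.rename_subst, fun A x => (ws A x).rename_subst θ ρ]
  | _, Comp.mu v ws, _, _, θ, ρ => by
    simp only [Comp.rename, Comp.subst, v.rename_subst, fun A x => (ws A x).rename_subst θ ρ,
      Sub.rename_lift₁]
  | _, Comp.op σ v t, _, _, θ, ρ => by
    simp only [Comp.rename, Comp.subst, v.rename_subst, t.rename_subst, Sub.rename_lift₁]
  | _, Comp.halt, _, _, θ, ρ => by simp only [Comp.rename, Comp.subst]
  | _, Comp.caseOf v s t, _, _, θ, ρ => by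
    simp only [Comp.rename, Comp.subst, v.rename_subst, s.rename_subst, t.rename_subst,
      Sub.rename_lift₁]

end

theorem Sub.lift₁_comp {Γ Δ Θ : Ctx} (θ : Sub Op Γ Δ) (θ' : Sub Op Δ Θ) (B : Ty) :
    (fun A x => (θ.lift₁ B A x).subst (θ'.lift₁ B)) =
      Sub.lift₁ (fun A x => (θ A x).subst θ') B := by
  funext A x
  cases x with
  | here => simp only [Sub.lift₁, Val.subst]
  | there x => simp only [Sub.lift₁, Val.rename_subst, Val.subst_rename]

theorem Sub.lift_comp {Γ Δ Θ : Ctx} (θ : Sub Op Γ Δ) (θ' : Sub Op Δ Θ) (Bs : List Ty) :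
    (fun A x => (θ.lift Bs A x).subst (θ'.lift Bs)) =
      Sub.lift (fun A x => (θ A x).subst θ') Bs := by
  induction Bs with
  | nil => rfl
  | cons B Bs ih => exact (Sub.lift₁_comp _ _ B).trans (congrArg (Sub.lift₁ · B) ih)

mutual

theorem Val.subst_subst : {Γ : Ctx} → {A : Ty} → (v : Val Op Γ A) → {Δ Θ : Ctx} →
    (θ : Sub Op Γ Δ) → (θ' : Sub Op Δ Θ) →
    (v.subst θ).subst θ' = v.subst (fun A x => (θ A x).subst θ')
  | _, _, Val.var x, _, _, θ, θ' => by simp only [Val.subst]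
  | _, _, Val.zero, _, _, θ, θ' => by simp only [Val.subst]
  | _, _, Val.succ v, _, _, θ, θ' => by simp only [Val.subst, v.subst_subst]
  | _, _, Val.star, _, _, θ, θ' => by simp only [Val.subst]
  | _, _, Val.lam As t, _, _, θ, θ' => by
    simp only [Val.subst, t.subst_subst, Sub.lift_comp]

theorem Comp.subst_subst : {Γ : Ctx} → (t : Comp Op Γ) → {Δ Θ : Ctx} →
    (θ : Sub Op Γ Δ) → (θ' : Sub Op Δ Θ) →
    (t.subst θ).subst θ' = t.subst (fun A x => (θ A x).subst θ')
  | _, Comp.app v ws, _, _, θ, θ' => by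
    simp only [Comp.subst, v.subst_subst, fun A x => (ws A x).subst_subst θ θ']
  | _, Comp.mu v ws, _, _, θ, θ' => by
    simp only [Comp.subst, v.subst_subst, fun A x => (ws A x).subst_subst θ θ', Sub.lift₁_comp]
  | _, Comp.op σ v t, _, _, θ, θ' => by
    simp only [Comp.subst, v.subst_subst, t.subst_subst, Sub.lift₁_comp]
  | _, Comp.halt, _, _, θ, θ' => by simp only [Comp.subst]
  | _, Comp.caseOf v s t, _, _, θ, θ' => by
    simp only [Comp.subst, v.subst_subst, s.subst_subst, t.subst_subst, Sub.lift₁_comp]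

end

theorem Sub.lift₁_id (Γ : Ctx) (B : Ty) :
    Sub.lift₁ (fun _ x => Val.var x : Sub Op Γ Γ) B = fun _ x => Val.var x := by
  funext A x
  cases x with
  | here => rfl
  | there x => simp only [Sub.lift₁, Val.rename]

theorem Sub.lift_id (Γ : Ctx) (Bs : List Ty) :
    Sub.lift (fun _ x => Val.var x : Sub Op Γ Γ) Bs = fun _ x => Val.var x := by
  induction Bs with
  | nil => rfl
  | cons B Bs ih => exact (congrArg (Sub.lift₁ · B) ih).trans (Sub.lift₁_id _ B)

mutual

theorem Val.subst_id : {Γ : Ctx} → {A : Ty} → (v : Val Op Γ A) →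
    v.subst (fun _ x => Val.var x) = v
  | _, _, Val.var x => by simp only [Val.subst]
  | _, _, Val.zero => by simp only [Val.subst]
  | _, _, Val.succ v => by simp only [Val.subst, v.subst_id]
  | _, _, Val.star => by simp only [Val.subst]
  | _, _, Val.lam As t => by simp only [Val.subst, Sub.lift_id, t.subst_id]

theorem Comp.subst_id : {Γ : Ctx} → (t : Comp Op Γ) → t.subst (fun _ x => Val.var x) = t
  | _, Comp.app v ws => by simp only [Comp.subst, v.subst_id, fun A x => (ws A x).subst_id]
  | _, Comp.mu v ws => by
    simp only [Comp.subst, v.subst_id, fun A x => (ws A x).subst_id, Sub.lift₁_id]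
  | _, Comp.op σ v t => by simp only [Comp.subst, v.subst_id, t.subst_id, Sub.lift₁_id]
  | _, Comp.halt => by simp only [Comp.subst]
  | _, Comp.caseOf v s t => by
    simp only [Comp.subst, v.subst_id, s.subst_id, t.subst_id, Sub.lift₁_id]

end

theorem Sub.eq_of_nil {Δ : Ctx} (θ θ' : Sub Op [] Δ) : θ = θ' := by
  funext A x
  cases x

theorem Val.subst_closed {A : Ty} (v : Val Op [] A) (θ : Sub Op [] []) : v.subst θ = v := by
  rw [Sub.eq_of_nil θ fun _ x => Val.var x, v.subst_id]

theorem Comp.subst_closed (t : Comp Op []) (θ : Sub Op [] []) : t.subst θ = t := by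
  rw [Sub.eq_of_nil θ fun _ x => Val.var x, t.subst_id]

/-- The renaming from the empty context. -/
def Ren.ofNil (Γ : Ctx) : Ren [] Γ := fun _ x => nomatch x

theorem Val.subst_rename_closed {A : Ty} {Γ : Ctx} (v : Val Op [] A) (ρ : Ren [] Γ)
    (θ : Sub Op Γ []) : (v.rename ρ).subst θ = v := by
  rw [v.subst_rename, v.subst_closed]

theorem Comp.subst_rename_closed {Γ : Ctx} (t : Comp Op []) (ρ : Ren [] Γ)
    (θ : Sub Op Γ []) : (t.rename ρ).subst θ = t := by
  rw [t.subst_rename, t.subst_closed]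

/-! ### Computation trees -/

theorem treeN_le_tree (n : ℕ) (t : Comp Op []) : treeN n t ≤ tree t :=
  OmegaCompletePartialOrder.le_ωSup
    ⟨⟨fun n => treeN n t, monotone_nat_of_le_succ fun n => treeN_le_succ n t⟩⟩ n

theorem tree_le {t : Comp Op []} {a : Tree Op} (h : ∀ n, treeN n t ≤ a) : tree t ≤ a :=
  OmegaCompletePartialOrder.ωSup_le _ _ h

theorem isLUB_tree (t : Comp Op []) : IsLUB (Set.range fun n => treeN n t) (tree t) :=
  ⟨by rintro _ ⟨n, rfl⟩; exact treeN_le_tree n t, fun _ ha => tree_le fun n => ha ⟨n, rfl⟩⟩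

theorem treeN_step {s t : Comp Op []} (h : t.next = Next.step s) (n : ℕ) :
    treeN (n + 1) t = treeN n s := by
  rw [treeN, h]

theorem treeN_effect {t : Comp Op []} {σ : Op} {m : ℕ} {s : ℕ → Comp Op []}
    (h : t.next = Next.effect σ m s) (n : ℕ) :
    treeN (n + 1) t = Tree.node σ m fun k => treeN n (s k) := by
  rw [treeN, h]

theorem tree_step {s t : Comp Op []} (h : t.next = Next.step s) : tree t = tree s := by
  apply le_antisymm
  · refine tree_le fun n => ?_
    cases n with
    | zero => exact Tree.bot_le' _
    | succ n => exact treeN_step h n ▸ treeN_le_tree n s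
  · exact tree_le fun n => treeN_step h n ▸ treeN_le_tree (n + 1) t

theorem tree_label {t : Comp Op []} {p : List ℕ} (h : (tree t).label p ≠ Label.bot) :
    ∃ n, (treeN n t).label p = (tree t).label p := by
  by_contra hn
  push Not at hn
  exact h (Tree.supLabel_bot _ fun n => ((treeN_le_tree n t p).resolve_right (hn n)))

theorem node_tree_le {t : Comp Op []} {σ : Op} {m : ℕ} {s : ℕ → Comp Op []}
    (h : t.next = Next.effect σ m s) : Tree.node σ m (fun k => tree (s k)) ≤ tree t := by
  have key : ∀ n p, (Tree.node σ m fun k => treeN n (s k)).label p ≠ Label.bot →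
      (Tree.node σ m fun k => treeN n (s k)).label p = (tree t).label p := fun n p hp =>
    ((treeN_effect h n ▸ treeN_le_tree (n + 1) t) p).resolve_left hp
  intro p
  cases p with
  | nil => exact Or.inr (key 0 [] fun hc => by cases hc)
  | cons k p =>
    by_cases hb : (tree (s k)).label p = Label.bot
    · exact Or.inl hb
    · obtain ⟨n, hn⟩ := tree_label hb
      exact Or.inr (hn.symm.trans (key n (k :: p) fun hc => hb (hn.symm.trans hc)))

/-! ### Applicative similarity and bisimilarity, explicitly -/

/-- `s` satisfies fewer observations than `t`. -/
def ObsLE (Obs : Set (Set (Tree Op))) (s t : Comp Op []) : Prop :=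
  ∀ P ∈ Obs, tree s ∈ P → tree t ∈ P

theorem ObsLE.trans {Obs : Set (Set (Tree Op))} {r s t : Comp Op []} (h : ObsLE Obs r s)
    (h' : ObsLE Obs s t) : ObsLE Obs r t := fun P hP hr => h' P hP (h P hP hr)

/-- Comparison of closed values: numerals are compared by equality, functions by the observations
satisfied by their applications to closed arguments. -/
def ValLE (Obs : Set (Set (Tree Op))) : (A : Ty) → Val Op [] A → Val Op [] A → Prop
  | Ty.unit, _, _ => True
  | Ty.nat, v, w => v = w
  | Ty.neg As, v, w => ∀ ws : Sub Op As [], ObsLE Obs (Comp.app v ws) (Comp.app w ws)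

theorem ValLE.refl (Obs : Set (Set (Tree Op))) : ∀ (A : Ty) (v : Val Op [] A), ValLE Obs A v v
  | Ty.unit, _ => trivial
  | Ty.nat, _ => rfl
  | Ty.neg _, _ => fun _ _ _ h => h

theorem ValLE.trans {Obs : Set (Set (Tree Op))} : ∀ {A : Ty} {u v w : Val Op [] A},
    ValLE Obs A u v → ValLE Obs A v w → ValLE Obs A u w
  | Ty.unit, _, _, _, _, _ => trivial
  | Ty.nat, _, _, _, h, h' => Eq.trans h h'
  | Ty.neg _, _, _, _, h, h' => fun ws => (h ws).trans (h' ws)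

theorem Val.eq_star : ∀ v : Val Op [] Ty.unit, v = Val.star
  | Val.star => rfl

theorem IsSimulation.valLE {Obs : Set (Set (Tree Op))} {R : ClosedRel Op}
    (hR : IsSimulation Obs R) : ∀ {A : Ty} {v w : Val Op [] A}, R.val A v w → ValLE Obs A v w
  | Ty.unit, _, _, _ => trivial
  | Ty.nat, _, _, h => hR.nat _ _ h
  | Ty.neg As, _, _, h => fun ws => hR.comp _ _ (hR.neg As _ _ h ws)

theorem similarity_eq (Obs : Set (Set (Tree Op))) :
    similarity Obs = ⟨ValLE Obs, ObsLE Obs⟩ := by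
  have hs : IsSimulation Obs ⟨ValLE Obs, ObsLE Obs⟩ :=
    { unit := fun v w _ => ⟨v.eq_star, w.eq_star⟩
      nat := fun _ _ h => h
      comp := fun _ _ h => h
      neg := fun _ _ _ h => h }
  ext
  · exact ⟨fun ⟨R, hR, h⟩ => hR.valLE h, fun h => ⟨_, hs, h⟩⟩
  · exact ⟨fun ⟨R, hR, h⟩ => hR.comp _ _ h, fun h => ⟨_, hs, h⟩⟩

theorem bisimilarity_eq (Obs : Set (Set (Tree Op))) :
    bisimilarity Obs = ⟨fun A v w => ValLE Obs A v w ∧ ValLE Obs A w v,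
      fun s t => ObsLE Obs s t ∧ ObsLE Obs t s⟩ := by
  have hs : IsBisimulation Obs ⟨fun A v w => ValLE Obs A v w ∧ ValLE Obs A w v,
      fun s t => ObsLE Obs s t ∧ ObsLE Obs t s⟩ :=
    { isSimulation :=
        { unit := fun v w _ => ⟨v.eq_star, w.eq_star⟩
          nat := fun _ _ h => h.1
          comp := fun _ _ h => h.1
          neg := fun _ _ _ h ws => ⟨h.1 ws, h.2 ws⟩ }
      symm_val := fun _ _ _ h => ⟨h.2, h.1⟩
      symm_comp := fun _ _ h => ⟨h.2, h.1⟩ }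
  ext
  · exact ⟨fun ⟨R, hR, h⟩ =>
      ⟨hR.isSimulation.valLE h, hR.isSimulation.valLE (hR.symm_val _ _ _ h)⟩,
      fun h => ⟨_, hs, h⟩⟩
  · exact ⟨fun ⟨R, hR, h⟩ =>
      ⟨hR.isSimulation.comp _ _ h, hR.isSimulation.comp _ _ (hR.symm_comp _ _ h)⟩,
      fun h => ⟨_, hs, h⟩⟩

/-- Comparison of open values: all closed instances are related. -/
def OpenValLE (Obs : Set (Set (Tree Op))) {Γ : Ctx} {A : Ty} (v w : Val Op Γ A) : Prop :=
  ∀ θ : Sub Op Γ [], ValLE Obs A (v.subst θ) (w.subst θ)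

/-- Comparison of open computations: all closed instances are related. -/
def OpenCompLE (Obs : Set (Set (Tree Op))) {Γ : Ctx} (s t : Comp Op Γ) : Prop :=
  ∀ θ : Sub Op Γ [], ObsLE Obs (s.subst θ) (t.subst θ)

section OpenLE

variable {Obs : Set (Set (Tree Op))} {Γ Δ : Ctx} {A : Ty}

theorem OpenValLE.refl (v : Val Op Γ A) : OpenValLE Obs v v := fun _ => ValLE.refl _ _ _

theorem OpenCompLE.refl (t : Comp Op Γ) : OpenCompLE Obs t t := fun _ _ _ h => h

theorem OpenValLE.trans {u v w : Val Op Γ A} (h : OpenValLE Obs u v) (h' : OpenValLE Obs v w) :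
    OpenValLE Obs u w := fun θ => (h θ).trans (h' θ)

theorem OpenCompLE.trans {r s t : Comp Op Γ} (h : OpenCompLE Obs r s) (h' : OpenCompLE Obs s t) :
    OpenCompLE Obs r t := fun θ => (h θ).trans (h' θ)

theorem OpenValLE.subst {v w : Val Op Γ A} (h : OpenValLE Obs v w) (θ : Sub Op Γ Δ) :
    OpenValLE Obs (v.subst θ) (w.subst θ) := fun θ' => by
  rw [v.subst_subst, w.subst_subst]; exact h _

theorem OpenCompLE.subst {s t : Comp Op Γ} (h : OpenCompLE Obs s t) (θ : Sub Op Γ Δ) :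
    OpenCompLE Obs (s.subst θ) (t.subst θ) := fun θ' => by
  rw [s.subst_subst, t.subst_subst]; exact h _

theorem OpenValLE.rename {v w : Val Op Γ A} (h : OpenValLE Obs v w) (ρ : Ren Γ Δ) :
    OpenValLE Obs (v.rename ρ) (w.rename ρ) := fun θ' => by
  rw [v.subst_rename, w.subst_rename]; exact h _

theorem OpenCompLE.rename {s t : Comp Op Γ} (h : OpenCompLE Obs s t) (ρ : Ren Γ Δ) :
    OpenCompLE Obs (s.rename ρ) (t.rename ρ) := fun θ' => by
  rw [s.subst_rename, t.subst_rename]; exact h _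

theorem OpenValLE.closed {v w : Val Op [] A} (h : OpenValLE Obs v w) : ValLE Obs A v w := by
  simpa only [Val.subst_id] using h fun _ x => Val.var x

theorem OpenCompLE.closed {s t : Comp Op []} (h : OpenCompLE Obs s t) : ObsLE Obs s t := by
  simpa only [Comp.subst_id] using h fun _ x => Val.var x

end OpenLE

/-! ### The Howe closure of similarity -/

mutual

/-- The Howe closure of the open extension of similarity, on values. -/
def Val.Howe (Obs : Set (Set (Tree Op))) :
    {Γ : Ctx} → {A : Ty} → Val Op Γ A → Val Op Γ A → Prop
  | _, _, Val.var x => fun w => OpenValLE Obs (Val.var x) w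
  | _, _, Val.zero => fun w => OpenValLE Obs Val.zero w
  | _, _, Val.succ v => fun w => ∃ v', v.Howe Obs v' ∧ OpenValLE Obs (Val.succ v') w
  | _, _, Val.star => fun w => OpenValLE Obs Val.star w
  | _, _, Val.lam As t => fun w => ∃ t', t.Howe Obs t' ∧ OpenValLE Obs (Val.lam As t') w

/-- The Howe closure of the open extension of similarity, on computations. -/
def Comp.Howe (Obs : Set (Set (Tree Op))) : {Γ : Ctx} → Comp Op Γ → Comp Op Γ → Prop
  | Γ, @Comp.app _ _ As v ws => fun r => ∃ v', ∃ ws' : Sub Op As Γ, v.Howe Obs v' ∧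
      (∀ A x, (ws A x).Howe Obs (ws' A x)) ∧ OpenCompLE Obs (Comp.app v' ws') r
  | Γ, @Comp.mu _ _ As v ws => fun r => ∃ v', ∃ ws' : Sub Op As Γ, v.Howe Obs v' ∧
      (∀ A x, (ws A x).Howe Obs (ws' A x)) ∧ OpenCompLE Obs (Comp.mu v' ws') r
  | _, Comp.op σ v t => fun r => ∃ v' t', v.Howe Obs v' ∧ t.Howe Obs t' ∧
      OpenCompLE Obs (Comp.op σ v' t') r
  | _, Comp.halt => fun r => OpenCompLE Obs Comp.halt r
  | _, Comp.caseOf v s t => fun r => ∃ v' s' t', v.Howe Obs v' ∧ s.Howe Obs s' ∧ t.Howe Obs t' ∧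
      OpenCompLE Obs (Comp.caseOf v' s' t') r

end

variable {Obs : Set (Set (Tree Op))}

mutual

theorem Val.Howe.refl : {Γ : Ctx} → {A : Ty} → (v : Val Op Γ A) → v.Howe Obs v
  | _, _, Val.var x => by rw [Val.Howe]; exact OpenValLE.refl _
  | _, _, Val.zero => by rw [Val.Howe]; exact OpenValLE.refl _
  | _, _, Val.succ v => by rw [Val.Howe]; exact ⟨v, Val.Howe.refl v, OpenValLE.refl _⟩
  | _, _, Val.star => by rw [Val.Howe]; exact OpenValLE.refl _
  | _, _, Val.lam As t => by rw [Val.Howe]; exact ⟨t, Comp.Howe.refl t, OpenValLE.refl _⟩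

theorem Comp.Howe.refl : {Γ : Ctx} → (t : Comp Op Γ) → t.Howe Obs t
  | _, Comp.app v ws => by
    rw [Comp.Howe]
    exact ⟨v, ws, Val.Howe.refl v, fun A x => Val.Howe.refl (ws A x), OpenCompLE.refl _⟩
  | _, Comp.mu v ws => by
    rw [Comp.Howe]
    exact ⟨v, ws, Val.Howe.refl v, fun A x => Val.Howe.refl (ws A x), OpenCompLE.refl _⟩
  | _, Comp.op σ v t => by
    rw [Comp.Howe]; exact ⟨v, t, Val.Howe.refl v, Comp.Howe.refl t, OpenCompLE.refl _⟩
  | _, Comp.halt => by rw [Comp.Howe]; exact OpenCompLE.refl _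
  | _, Comp.caseOf v s t => by
    rw [Comp.Howe]
    exact ⟨v, s, t, Val.Howe.refl v, Comp.Howe.refl s, Comp.Howe.refl t, OpenCompLE.refl _⟩

end

theorem Val.Howe.trans_le {Γ : Ctx} {A : Ty} {u v w : Val Op Γ A} (h : u.Howe Obs v)
    (h' : OpenValLE Obs v w) : u.Howe Obs w := by
  cases u <;> simp only [Val.Howe] at h ⊢
  case var | zero | star => exact h.trans h'
  case succ | lam => exact h.imp fun _ h => ⟨h.1, h.2.trans h'⟩

theorem Comp.Howe.trans_le {Γ : Ctx} {r s t : Comp Op Γ} (h : r.Howe Obs s)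
    (h' : OpenCompLE Obs s t) : r.Howe Obs t := by
  cases r <;> simp only [Comp.Howe] at h ⊢
  case app | mu =>
    obtain ⟨v', ws', hv, hws, h⟩ := h
    exact ⟨v', ws', hv, hws, h.trans h'⟩
  case op =>
    obtain ⟨v', t', hv, ht, h⟩ := h
    exact ⟨v', t', hv, ht, h.trans h'⟩
  case halt => exact h.trans h'
  case caseOf =>
    obtain ⟨v', s', t', hv, hs, ht, h⟩ := h
    exact ⟨v', s', t', hv, hs, ht, h.trans h'⟩

mutual

theorem Val.Howe.rename : {Γ : Ctx} → {A : Ty} → (v : Val Op Γ A) → (w : Val Op Γ A) →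
    v.Howe Obs w → {Δ : Ctx} → (ρ : Ren Γ Δ) → (v.rename ρ).Howe Obs (w.rename ρ)
  | _, _, Val.var x, w, h, _, ρ => by
    simp only [Val.Howe, Val.rename] at h ⊢
    simpa only [Val.rename] using h.rename ρ
  | _, _, Val.zero, w, h, _, ρ => by
    simp only [Val.Howe, Val.rename] at h ⊢
    simpa only [Val.rename] using h.rename ρ
  | _, _, Val.succ v, w, h, _, ρ => by
    simp only [Val.Howe, Val.rename] at h ⊢
    obtain ⟨v', hv, h⟩ := h
    exact ⟨_, Val.Howe.rename v v' hv ρ, by simpa only [Val.rename] using h.rename ρ⟩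
  | _, _, Val.star, w, h, _, ρ => by
    simp only [Val.Howe, Val.rename] at h ⊢
    simpa only [Val.rename] using h.rename ρ
  | _, _, Val.lam As t, w, h, _, ρ => by
    simp only [Val.Howe, Val.rename] at h ⊢
    obtain ⟨t', ht, h⟩ := h
    exact ⟨_, Comp.Howe.rename t t' ht _, by simpa only [Val.rename] using h.rename ρ⟩

theorem Comp.Howe.rename : {Γ : Ctx} → (s : Comp Op Γ) → (r : Comp Op Γ) →
    s.Howe Obs r → {Δ : Ctx} → (ρ : Ren Γ Δ) → (s.rename ρ).Howe Obs (r.rename ρ)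
  | _, Comp.app v ws, r, h, _, ρ => by
    simp only [Comp.Howe, Comp.rename] at h ⊢
    obtain ⟨v', ws', hv, hws, h⟩ := h
    exact ⟨_, _, Val.Howe.rename v v' hv ρ,
      fun A x => Val.Howe.rename (ws A x) (ws' A x) (hws A x) ρ,
      by simpa only [Comp.rename] using h.rename ρ⟩
  | _, Comp.mu v ws, r, h, _, ρ => by
    simp only [Comp.Howe, Comp.rename] at h ⊢
    obtain ⟨v', ws', hv, hws, h⟩ := h
    exact ⟨_, _, Val.Howe.rename v v' hv _,
      fun A x => Val.Howe.rename (ws A x) (ws' A x) (hws A x) ρ,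
      by simpa only [Comp.rename] using h.rename ρ⟩
  | _, Comp.op σ v t, r, h, _, ρ => by
    simp only [Comp.Howe, Comp.rename] at h ⊢
    obtain ⟨v', t', hv, ht, h⟩ := h
    exact ⟨_, _, Val.Howe.rename v v' hv ρ, Comp.Howe.rename t t' ht _,
      by simpa only [Comp.rename] using h.rename ρ⟩
  | _, Comp.halt, r, h, _, ρ => by
    simp only [Comp.Howe, Comp.rename] at h ⊢
    simpa only [Comp.rename] using h.rename ρ
  | _, Comp.caseOf v s t, r, h, _, ρ => by
    simp only [Comp.Howe, Comp.rename] at h ⊢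
    obtain ⟨v', s', t', hv, hs, ht, h⟩ := h
    exact ⟨_, _, _, Val.Howe.rename v v' hv ρ, Comp.Howe.rename s s' hs ρ,
      Comp.Howe.rename t t' ht _, by simpa only [Comp.rename] using h.rename ρ⟩

end

/-- The Howe closure on substitutions. -/
def Sub.Howe (Obs : Set (Set (Tree Op))) {Γ Δ : Ctx} (θ θ' : Sub Op Γ Δ) : Prop :=
  ∀ A x, (θ A x).Howe Obs (θ' A x)

theorem Sub.Howe.lift₁ {Γ Δ : Ctx} {θ θ' : Sub Op Γ Δ} (h : θ.Howe Obs θ') (B : Ty) :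
    (θ.lift₁ B).Howe Obs (θ'.lift₁ B) := by
  intro A x
  cases x with
  | here => exact Val.Howe.refl _
  | there x => exact Val.Howe.rename _ _ (h A x) _

theorem Sub.Howe.lift {Γ Δ : Ctx} {θ θ' : Sub Op Γ Δ} (h : θ.Howe Obs θ') :
    ∀ Bs : List Ty, (θ.lift Bs).Howe Obs (θ'.lift Bs)
  | [] => h
  | B :: Bs => (h.lift Bs).lift₁ B

theorem Sub.Howe.single {Γ : Ctx} {B : Ty} {v w : Val Op Γ B} (h : v.Howe Obs w) :
    (Sub.single v).Howe Obs (Sub.single w) := by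
  intro A x
  cases x with
  | here => exact h
  | there x => exact Val.Howe.refl _

theorem Sub.Howe.inst {Γ : Ctx} : ∀ (Bs : List Ty) {ws ws' : Sub Op Bs Γ}, ws.Howe Obs ws' →
    (Sub.inst Bs ws).Howe Obs (Sub.inst Bs ws')
  | [], _, _, _, _, _ => Val.Howe.refl _
  | _ :: _, _, _, h, _, Var.here => h _ _
  | _ :: Bs, _, _, h, _, Var.there x => Sub.Howe.inst Bs (fun _ y => h _ (Var.there y)) _ x

mutual

theorem Val.Howe.subst : {Γ : Ctx} → {A : Ty} → (v : Val Op Γ A) → (w : Val Op Γ A) →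
    v.Howe Obs w → {Δ : Ctx} → (θ θ' : Sub Op Γ Δ) → θ.Howe Obs θ' →
    (v.subst θ).Howe Obs (w.subst θ')
  | _, _, Val.var x, w, h, _, θ, θ', hθ => by
    simp only [Val.Howe, Val.subst] at h ⊢
    exact (hθ _ x).trans_le (by simpa only [Val.subst] using h.subst θ')
  | _, _, Val.zero, w, h, _, θ, θ', hθ => by
    simp only [Val.Howe, Val.subst] at h ⊢
    simpa only [Val.subst] using h.subst θ'
  | _, _, Val.succ v, w, h, _, θ, θ', hθ => by
    simp only [Val.Howe, Val.subst] at h ⊢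
    obtain ⟨v', hv, h⟩ := h
    exact ⟨_, Val.Howe.subst v v' hv θ θ' hθ, by simpa only [Val.subst] using h.subst θ'⟩
  | _, _, Val.star, w, h, _, θ, θ', hθ => by
    simp only [Val.Howe, Val.subst] at h ⊢
    simpa only [Val.subst] using h.subst θ'
  | _, _, Val.lam As t, w, h, _, θ, θ', hθ => by
    simp only [Val.Howe, Val.subst] at h ⊢
    obtain ⟨t', ht, h⟩ := h
    exact ⟨_, Comp.Howe.subst t t' ht _ _ (hθ.lift As),
      by simpa only [Val.subst] using h.subst θ'⟩

theorem Comp.Howe.subst : {Γ : Ctx} → (s : Comp Op Γ) → (r : Comp Op Γ) →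
    s.Howe Obs r → {Δ : Ctx} → (θ θ' : Sub Op Γ Δ) → θ.Howe Obs θ' →
    (s.subst θ).Howe Obs (r.subst θ')
  | _, Comp.app v ws, r, h, _, θ, θ', hθ => by
    simp only [Comp.Howe, Comp.subst] at h ⊢
    obtain ⟨v', ws', hv, hws, h⟩ := h
    exact ⟨_, _, Val.Howe.subst v v' hv θ θ' hθ,
      fun A x => Val.Howe.subst (ws A x) (ws' A x) (hws A x) θ θ' hθ,
      by simpa only [Comp.subst] using h.subst θ'⟩
  | _, Comp.mu v ws, r, h, _, θ, θ', hθ => by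
    simp only [Comp.Howe, Comp.subst] at h ⊢
    obtain ⟨v', ws', hv, hws, h⟩ := h
    exact ⟨_, _, Val.Howe.subst v v' hv _ _ (hθ.lift₁ _),
      fun A x => Val.Howe.subst (ws A x) (ws' A x) (hws A x) θ θ' hθ,
      by simpa only [Comp.subst] using h.subst θ'⟩
  | _, Comp.op σ v t, r, h, _, θ, θ', hθ => by
    simp only [Comp.Howe, Comp.subst] at h ⊢
    obtain ⟨v', t', hv, ht, h⟩ := h
    exact ⟨_, _, Val.Howe.subst v v' hv θ θ' hθ, Comp.Howe.subst t t' ht _ _ (hθ.lift₁ _),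
      by simpa only [Comp.subst] using h.subst θ'⟩
  | _, Comp.halt, r, h, _, θ, θ', hθ => by
    simp only [Comp.Howe, Comp.subst] at h ⊢
    simpa only [Comp.subst] using h.subst θ'
  | _, Comp.caseOf v s t, r, h, _, θ, θ', hθ => by
    simp only [Comp.Howe, Comp.subst] at h ⊢
    obtain ⟨v', s', t', hv, hs, ht, h⟩ := h
    exact ⟨_, _, _, Val.Howe.subst v v' hv θ θ' hθ, Comp.Howe.subst s s' hs θ θ' hθ,
      Comp.Howe.subst t t' ht _ _ (hθ.lift₁ _), by simpa only [Comp.subst] using h.subst θ'⟩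

end

theorem Val.Howe.eq_of_nat : ∀ v w : Val Op [] Ty.nat, v.Howe Obs w → v = w
  | Val.zero, w, h => by
    rw [Val.Howe] at h
    exact h.closed
  | Val.succ v, w, h => by
    rw [Val.Howe] at h
    obtain ⟨v', hv, h⟩ := h
    rw [Val.Howe.eq_of_nat v v' hv]
    exact h.closed

theorem muFun_howe {Γ : Ctx} {As : List Ty} {v v' : Val Op (Ty.neg As :: Γ) (Ty.neg As)}
    (h : v.Howe Obs v') : (muFun v).Howe Obs (muFun v') := by
  rw [muFun, muFun, Val.Howe]
  refine ⟨_, ?_, OpenValLE.refl _⟩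
  rw [Comp.Howe]
  exact ⟨_, _, Val.Howe.rename _ _ h _, fun _ _ => Val.Howe.refl _, OpenCompLE.refl _⟩

/-- Howe-related computations satisfy the observations of the finite approximations. -/
theorem Comp.Howe.mem_of_treeN_mem (hdec : Decomposable Obs) (hopen : ∀ P ∈ Obs, ScottOpen P)
    (n : ℕ) : ∀ s t : Comp Op [], s.Howe Obs t → ∀ P ∈ Obs, treeN n s ∈ P → tree t ∈ P := by
  induction n with
  | zero => exact fun s t _ P hP h => (hopen P hP).1 _ _ h (Tree.bot_le' _)
  | succ n ih =>
    intro s t hst P hP hs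
    match s, hst, hs with
    | Comp.app (Val.lam As s₀) ws, hst, hs =>
      rw [Comp.Howe] at hst
      obtain ⟨v', ws', hv, hws, ht⟩ := hst
      rw [Val.Howe] at hv
      obtain ⟨s₁, hs₁, hv⟩ := hv
      rw [treeN_step rfl] at hs
      have h := ih _ _ (Comp.Howe.subst _ _ hs₁ _ _ (Sub.Howe.inst As hws)) P hP hs
      exact ht.closed P hP (hv.closed ws' P hP (by rwa [tree_step rfl]))
    | Comp.mu v ws, hst, hs =>
      rw [Comp.Howe] at hst
      obtain ⟨v', ws', hv, hws, ht⟩ := hst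
      rw [treeN_step rfl] at hs
      have h : (Comp.app (v.subst (Sub.single (muFun v))) ws).Howe Obs
          (Comp.app (v'.subst (Sub.single (muFun v'))) ws') := by
        rw [Comp.Howe]
        exact ⟨_, _, Val.Howe.subst _ _ hv _ _ (Sub.Howe.single (muFun_howe hv)), hws,
          OpenCompLE.refl _⟩
      exact ht.closed P hP (by rw [tree_step rfl]; exact ih _ _ h P hP hs)
    | Comp.op σ v s₀, hst, hs =>
      rw [Comp.Howe] at hst
      obtain ⟨v', s₁, hv, hs₁, ht⟩ := hst
      obtain rfl := Val.Howe.eq_of_nat _ _ hv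
      rw [treeN_effect rfl] at hs
      obtain ⟨P', hP', hmem, hnode⟩ := hdec P hP _ _ _ hs
      refine ht.closed P hP ((hopen P hP).1 _ _ (hnode _ fun k => ?_) (node_tree_le rfl))
      exact ih _ _ (Comp.Howe.subst _ _ hs₁ _ _ (Sub.Howe.single (Val.Howe.refl _))) _ (hP' k)
        (hmem k)
    | Comp.halt, hst, hs =>
      rw [Comp.Howe] at hst
      exact hst.closed P hP ((hopen P hP).1 _ _ hs (treeN_le_tree _ _))
    | Comp.caseOf Val.zero s₀ t₀, hst, hs =>
      rw [Comp.Howe] at hst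
      obtain ⟨v', s₁, t₁, hv, hs₁, ht₁, ht⟩ := hst
      obtain rfl := Val.Howe.eq_of_nat _ _ hv
      rw [treeN_step rfl] at hs
      exact ht.closed P hP (by rw [tree_step rfl]; exact ih _ _ hs₁ P hP hs)
    | Comp.caseOf (Val.succ v) s₀ t₀, hst, hs =>
      rw [Comp.Howe] at hst
      obtain ⟨v', s₁, t₁, hv, hs₁, ht₁, ht⟩ := hst
      obtain rfl := Val.Howe.eq_of_nat _ _ hv
      rw [treeN_step rfl] at hs
      refine ht.closed P hP ?_
      rw [tree_step rfl]
      exact ih _ _ (Comp.Howe.subst _ _ ht₁ _ _ (Sub.Howe.single (Val.Howe.refl _))) P hP hs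

theorem Comp.Howe.obsLE (hdec : Decomposable Obs) (hopen : ∀ P ∈ Obs, ScottOpen P)
    {s t : Comp Op []} (h : s.Howe Obs t) : ObsLE Obs s t := fun P hP hs =>
  let ⟨n, hn⟩ := (hopen P hP).2 (fun n => treeN n s)
    (monotone_nat_of_le_succ fun n => treeN_le_succ n s) _ (isLUB_tree s) hs
  h.mem_of_treeN_mem hdec hopen n _ _ P hP hn

theorem Val.Howe.valLE (hdec : Decomposable Obs) (hopen : ∀ P ∈ Obs, ScottOpen P) :
    ∀ {A : Ty} {v w : Val Op [] A}, v.Howe Obs w → ValLE Obs A v w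
  | Ty.unit, _, _, _ => trivial
  | Ty.nat, _, _, h => Val.Howe.eq_of_nat _ _ h
  | Ty.neg _, _, _, h => fun ws => Comp.Howe.obsLE hdec hopen <| by
      rw [Comp.Howe]
      exact ⟨_, ws, h, fun _ _ => Val.Howe.refl _, OpenCompLE.refl _⟩

theorem Val.howe_iff (hdec : Decomposable Obs) (hopen : ∀ P ∈ Obs, ScottOpen P) {Γ : Ctx} {A : Ty}
    {v w : Val Op Γ A} : v.Howe Obs w ↔ OpenValLE Obs v w :=
  ⟨fun h θ => (Val.Howe.subst _ _ h θ θ fun _ _ => Val.Howe.refl _).valLE hdec hopen,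
    fun h => (Val.Howe.refl v).trans_le h⟩

theorem Comp.howe_iff (hdec : Decomposable Obs) (hopen : ∀ P ∈ Obs, ScottOpen P) {Γ : Ctx}
    {s t : Comp Op Γ} : s.Howe Obs t ↔ OpenCompLE Obs s t :=
  ⟨fun h θ => (Comp.Howe.subst _ _ h θ θ fun _ _ => Val.Howe.refl _).obsLE hdec hopen,
    fun h => (Comp.Howe.refl s).trans_le h⟩

theorem compatible_openLE (hdec : Decomposable Obs) (hopen : ∀ P ∈ Obs, ScottOpen P) :
    Compatible (⟨fun _ _ => OpenValLE Obs, fun _ => OpenCompLE Obs⟩ : OpenRel Op) := by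
  have e : (⟨fun _ _ => OpenValLE Obs, fun _ => OpenCompLE Obs⟩ : OpenRel Op) =
      ⟨fun _ _ => Val.Howe Obs, fun _ => Comp.Howe Obs⟩ := by
    ext
    · exact (Val.howe_iff hdec hopen).symm
    · exact (Comp.howe_iff hdec hopen).symm
  rw [e]
  constructor
  case lam => exact fun _ _ _ t h => by simp only [Val.Howe]; exact ⟨t, h, OpenValLE.refl _⟩
  case succ => exact fun _ _ v' h => by simp only [Val.Howe]; exact ⟨v', h, OpenValLE.refl _⟩
  case app | mu =>
    exact fun _ _ _ v' _ ws' hv hws => by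
      simp only [Comp.Howe]; exact ⟨v', ws', hv, hws, OpenCompLE.refl _⟩
  case op =>
    exact fun _ _ _ v' _ t' hv ht => by
      simp only [Comp.Howe]; exact ⟨v', t', hv, ht, OpenCompLE.refl _⟩
  case caseOf =>
    exact fun _ _ v' _ s' _ t' hv hs ht => by
      simp only [Comp.Howe]; exact ⟨v', s', t', hv, hs, ht, OpenCompLE.refl _⟩
  case var | star | zero => intros; exact Val.Howe.refl _
  case halt => exact fun _ => Comp.Howe.refl _

/-! ### The contextual preorder is contained in similarity -/

mutual

theorem Compatible.refl_val {R : OpenRel Op} (hR : Compatible R) :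
    {Γ : Ctx} → {A : Ty} → (v : Val Op Γ A) → R.val Γ A v v
  | _, _, Val.var x => hR.var _ _ x
  | _, _, Val.zero => hR.zero _
  | _, _, Val.succ v => hR.succ _ _ _ (hR.refl_val v)
  | _, _, Val.star => hR.star _
  | _, _, Val.lam As t => hR.lam _ As _ _ (hR.refl_comp t)

theorem Compatible.refl_comp {R : OpenRel Op} (hR : Compatible R) :
    {Γ : Ctx} → (t : Comp Op Γ) → R.comp Γ t t
  | _, Comp.app v ws => hR.app _ _ _ _ _ _ (hR.refl_val v) fun A x => hR.refl_val (ws A x)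
  | _, Comp.mu v ws => hR.mu _ _ _ _ _ _ (hR.refl_val v) fun A x => hR.refl_val (ws A x)
  | _, Comp.op σ v t => hR.op _ σ _ _ _ _ (hR.refl_val v) (hR.refl_comp t)
  | _, Comp.halt => hR.halt _
  | _, Comp.caseOf v s t =>
    hR.caseOf _ _ _ _ _ _ _ (hR.refl_val v) (hR.refl_comp s) (hR.refl_comp t)

end

/-- The one-element tuple of values. -/
def Sub.tuple₁ {Γ : Ctx} {A : Ty} (v : Val Op Γ A) : Sub Op [A] Γ
  | _, Var.here => v

/-- The extension of a substitution by the value of one more variable. -/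
def Sub.cons {Γ Δ : Ctx} {A : Ty} (v : Val Op Δ A) (θ : Sub Op Γ Δ) : Sub Op (A :: Γ) Δ
  | _, Var.here => v
  | _, Var.there x => θ _ x

theorem tree_app_lam_singleton {Γ : Ctx} {A : Ty} (s : Comp Op (A :: Γ)) (v : Val Op Γ A)
    (θ : Sub Op Γ []) :
    tree ((Comp.app (Val.lam [A] s) (Sub.tuple₁ v)).subst θ) =
      tree (s.subst (Sub.cons (v.subst θ) θ)) := by
  simp only [Comp.subst, Val.subst]
  rw [tree_step rfl]
  erw [Comp.subst_subst]
  congr 2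
  funext B x
  cases x with
  | here => rfl
  | there x =>
    simp only [Sub.lift, Sub.lift₁, Val.subst_rename]
    exact Val.subst_closed _ _

theorem Compatible.openCompLE {R : OpenRel Op} (hR : Compatible R) (hA : Adequate Obs R) :
    ∀ {Γ : Ctx} {s t : Comp Op Γ}, R.comp Γ s t → OpenCompLE Obs s t
  | [], s, t, h, θ => by rw [s.subst_closed, t.subst_closed]; exact hA s t h
  | A :: Γ, s, t, h, θ => by
    have h' := hR.openCompLE hA (hR.app _ _ _ _ _ _ (hR.lam Γ [A] s t h)
      fun B x => hR.refl_val (Sub.tuple₁ ((θ A Var.here).rename (Ren.ofNil Γ)) B x))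
      fun _ x => θ _ (Var.there x)
    have e : Sub.cons (θ A Var.here) (fun _ x => θ _ (Var.there x)) = θ := by
      funext B x
      cases x <;> rfl
    intro P hP hs
    have := h' P hP
    rw [tree_app_lam_singleton, tree_app_lam_singleton, Val.subst_rename_closed, e] at this
    exact this hs

/-- A closed computation that diverges without effects. -/
def diverge (Op : Type u) : Comp Op [] :=
  Comp.mu (As := []) (Val.var Var.here) fun _ x => nomatch x

theorem treeN_diverge (n : ℕ) : treeN n (diverge Op) = ⊥ := by
  induction n using Nat.strong_induction_on with
  | _ n ih =>
    match n with
    | 0 => rfl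
    | 1 => rfl
    | n + 2 =>
      rw [diverge, treeN_step rfl, treeN_step rfl, ← ih n (by omega), diverge]
      congr 1
      simp only [Comp.subst, Val.subst, Val.rename, Ren.lift₁, Sub.lift₁]
      congr 1
      exact Sub.eq_of_nil _ _

theorem tree_diverge : tree (diverge Op) = ⊥ :=
  le_antisymm (tree_le fun n => (treeN_diverge n).le) (Tree.bot_le' _)

/-- The renaming of a single variable to the last variable of a context. -/
def Ren.head (A : Ty) (Γ : Ctx) : Ren [A] (A :: Γ)
  | _, Var.here => Var.here

/-- The computation that behaves like `t` if its argument is `n`, and diverges otherwise. -/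
def isNumeral (t : Comp Op []) : ℕ → Comp Op [Ty.nat]
  | 0 => Comp.caseOf (Val.var Var.here) (t.rename (Ren.ofNil _))
      ((diverge Op).rename (Ren.ofNil _))
  | n + 1 => Comp.caseOf (Val.var Var.here) ((diverge Op).rename (Ren.ofNil _))
      ((isNumeral t n).rename (Ren.head _ _))

theorem tree_isNumeral (t : Comp Op []) : ∀ (n : ℕ) (v : Val Op [] Ty.nat) (θ : Sub Op [Ty.nat] []),
    θ _ Var.here = v → tree ((isNumeral t n).subst θ) = if v.toNat = n then tree t else ⊥
  | 0, Val.zero, θ, h => by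
    simp only [isNumeral, Comp.subst, Val.subst, h]
    rw [tree_step rfl, Comp.subst_rename_closed, Val.toNat, if_pos rfl]
    · nofun
  | 0, Val.succ v, θ, h => by
    simp only [isNumeral, Comp.subst, Val.subst, h]
    rw [tree_step rfl, Comp.subst_subst, Comp.subst_rename_closed, tree_diverge, Val.toNat,
      if_neg (by omega)]
  | n + 1, Val.zero, θ, h => by
    simp only [isNumeral, Comp.subst, Val.subst, h]
    rw [tree_step rfl, Comp.subst_rename_closed, tree_diverge, Val.toNat, if_neg (by omega)]
    · nofun
  | n + 1, Val.succ v, θ, h => by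
    simp only [isNumeral, Comp.subst, Val.subst, h]
    rw [tree_step rfl, Comp.subst_subst, Comp.subst_rename, tree_isNumeral t n v _ rfl, Val.toNat]
    simp only [Nat.add_right_cancel_iff]

theorem Compatible.openValLE_nat (hopen : ∀ P ∈ Obs, ScottOpen P) (hcons : Consistent Obs)
    {R : OpenRel Op} (hR : Compatible R) (hA : Adequate Obs R) {Γ : Ctx} {v w : Val Op Γ Ty.nat}
    (h : R.val Γ Ty.nat v w) (θ : Sub Op Γ []) : v.subst θ = w.subst θ := by
  obtain ⟨P, hP, hne, t, ht⟩ := hcons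
  have hbot : ⊥ ∉ P := fun hb => hne (Set.eq_univ_of_forall fun a =>
    (hopen P hP).1 _ a hb (Tree.bot_le' a))
  set n := (v.subst θ).toNat with hn
  have key := hR.openCompLE hA (hR.app Γ [Ty.nat] _ _ (Sub.tuple₁ v) (Sub.tuple₁ w)
    (hR.refl_val (Val.lam [Ty.nat] ((isNumeral t n).rename (Ren.head _ _)))) (by
      intro A x
      cases x with
      | here => exact h
      | there x => cases x)) θ P hP
  rw [tree_app_lam_singleton, tree_app_lam_singleton, Comp.subst_rename, Comp.subst_rename,
    tree_isNumeral t n (v.subst θ) _ rfl, tree_isNumeral t n (w.subst θ) _ rfl, if_pos hn.symm]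
    at key
  have hnw : (w.subst θ).toNat = n := by
    by_contra hc
    rw [if_neg hc] at key
    exact hbot (key ht)
  rw [← numeral_toNat (v.subst θ), ← numeral_toNat (w.subst θ), hnw]

theorem Compatible.openValLE (hopen : ∀ P ∈ Obs, ScottOpen P) (hcons : Consistent Obs)
    {R : OpenRel Op} (hR : Compatible R) (hA : Adequate Obs R) {Γ : Ctx} :
    ∀ {A : Ty} {v w : Val Op Γ A}, R.val Γ A v w → OpenValLE Obs v w
  | Ty.unit, _, _, _, _ => trivial
  | Ty.nat, _, _, h, θ => hR.openValLE_nat hopen hcons hA h θ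
  | Ty.neg As, v, w, h, θ => fun ws => by
    have := hR.openCompLE hA (hR.app Γ As v w _ _ h fun B x =>
      hR.refl_val ((ws B x).rename (Ren.ofNil Γ))) θ
    simpa only [Comp.subst, Val.subst_rename_closed] using this

theorem Compatible.converse {R : OpenRel Op} (hR : Compatible R) :
    Compatible (⟨fun Γ A v w => R.val Γ A w v, fun Γ s t => R.comp Γ t s⟩ : OpenRel Op) where
  var := hR.var
  star := hR.star
  lam _ _ _ _ := hR.lam _ _ _ _
  zero := hR.zero
  succ _ _ _ := hR.succ _ _ _
  app _ _ _ _ _ _ := hR.app _ _ _ _ _ _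
  mu _ _ _ _ _ _ := hR.mu _ _ _ _ _ _
  op _ _ _ _ _ _ := hR.op _ _ _ _ _ _
  halt := hR.halt
  caseOf _ _ _ _ _ _ _ := hR.caseOf _ _ _ _ _ _ _

theorem Compatible.inter {R S : OpenRel Op} (hR : Compatible R) (hS : Compatible S) :
    Compatible (⟨fun Γ A v w => R.val Γ A v w ∧ S.val Γ A v w,
      fun Γ s t => R.comp Γ s t ∧ S.comp Γ s t⟩ : OpenRel Op) where
  var Γ A x := ⟨hR.var Γ A x, hS.var Γ A x⟩
  star Γ := ⟨hR.star Γ, hS.star Γ⟩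
  lam _ _ _ _ h := ⟨hR.lam _ _ _ _ h.1, hS.lam _ _ _ _ h.2⟩
  zero Γ := ⟨hR.zero Γ, hS.zero Γ⟩
  succ _ _ _ h := ⟨hR.succ _ _ _ h.1, hS.succ _ _ _ h.2⟩
  app _ _ _ _ _ _ h h' := ⟨hR.app _ _ _ _ _ _ h.1 fun A x => (h' A x).1,
    hS.app _ _ _ _ _ _ h.2 fun A x => (h' A x).2⟩
  mu _ _ _ _ _ _ h h' := ⟨hR.mu _ _ _ _ _ _ h.1 fun A x => (h' A x).1,
    hS.mu _ _ _ _ _ _ h.2 fun A x => (h' A x).2⟩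
  op _ _ _ _ _ _ h h' := ⟨hR.op _ _ _ _ _ _ h.1 h'.1, hS.op _ _ _ _ _ _ h.2 h'.2⟩
  halt Γ := ⟨hR.halt Γ, hS.halt Γ⟩
  caseOf _ _ _ _ _ _ _ h h' h'' :=
    ⟨hR.caseOf _ _ _ _ _ _ _ h.1 h'.1 h''.1, hS.caseOf _ _ _ _ _ _ _ h.2 h'.2 h''.2⟩

end ECPS

theorem mainTheorem2 {Op : Type*} (Obs : Set (Set (ECPS.Tree Op)))
    (hdec : ECPS.Decomposable Obs)
    (hopen : ∀ P ∈ Obs, ECPS.ScottOpen P)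
    (hcons : ECPS.Consistent Obs) :
    (ECPS.similarity Obs).openExt = ECPS.contextualPreorder Obs ∧
    (ECPS.bisimilarity Obs).openExt = ECPS.contextualEquivalence Obs := by
  have hc := ECPS.compatible_openLE hdec hopen
  constructor
  · rw [ECPS.similarity_eq]
    ext
    · exact ⟨fun h => ⟨_, hc, fun _ _ h => h.closed, h⟩,
        fun ⟨R, hR, hA, h⟩ => hR.openValLE hopen hcons hA h⟩
    · exact ⟨fun h => ⟨_, hc, fun _ _ h => h.closed, h⟩,
        fun ⟨R, hR, hA, h⟩ => hR.openCompLE hA h⟩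
  · have hb := hc.inter hc.converse
    rw [ECPS.bisimilarity_eq]
    ext
    · exact ⟨fun h => ⟨_, hb, fun _ _ h P hP => ⟨h.1.closed P hP, h.2.closed P hP⟩,
          ⟨fun θ => (h θ).1, fun θ => (h θ).2⟩⟩,
        fun ⟨R, hR, hA, h⟩ θ =>
          ⟨hR.openValLE hopen hcons (fun s t h P hP => (hA s t h P hP).1) h θ,
            hR.converse.openValLE hopen hcons (fun s t h P hP => (hA t s h P hP).2) h θ⟩⟩
    · exact ⟨fun h => ⟨_, hb, fun _ _ h P hP => ⟨h.1.closed P hP, h.2.closed P hP⟩,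
          ⟨fun θ => (h θ).1, fun θ => (h θ).2⟩⟩,
        fun ⟨R, hR, hA, h⟩ θ =>
          ⟨hR.openCompLE (fun s t h P hP => (hA s t h P hP).1) h θ,
            hR.converse.openCompLE (fun s t h P hP => (hA t s h P hP).2) h θ⟩⟩
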